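/- **Setting.** One item is sold to $n$ bidders. Bidder $i$ has a finite set $T_i\subset\mathbb{R}_+^2$ of possible types $t_i=(v_i,b_i)$ (value for the item, budget) and a probability distribution $D_i$ on $T_i$; types are drawn independently, $t\sim D=\times_i D_i$. A (randomized) mechanism has a random seed $r$, independent of the types, and on a reported profile $t\in\times_i T_i$ it awards the item to at most one bidder ($x_i(t,r)\in\{0,1\}$, $\sum_i x_i(t,r)\le 1$) and charges prices $q_i(t,r)\in\mathbb{R}$. Its interim form consists of $\pi_i(t_i)=\mathbb{E}_{t_{-i}\sim D_{-i},\,r}[x_i(t_i,t_{-i},r)]$ and $p_i(t_i)=\mathbb{E}_{t_{-i}\sim D_{-i},\,r}[q_i(t_i,t_{-i},r)]$ for $i\in[n]$, $t_i\in T_i$. A mechanism is *admissible* if it is * Bayesian incentive compatible: $v_i\,\pi_i(t_i)-p_i(t_i)\ \ge\ v_i\,\pi_i(t_i')-p_i(t_i')$ for all $i$ and all $t_i=(v_i,b_i),\,t'_i=(v'_i,b'_i)\in T_i$; * ex-post individually rational, budget respecting and without positive transfers: $0\le q_i(t,r)\le\min\{b_i,\ v_i\,x_i(t,r)\}$ for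 all $i$, all profiles $t$ and all seeds $r$. A mechanism is *optimal* if it is admissible and its expected revenue $\mathbb{E}_{t\sim D,\,r}[\sum_i q_i(t,r)]$ is maximal among all admissible mechanisms. **Statement.** An optimal mechanism exists, and every optimal mechanism can be implemented as a distribution over virtual value maximizers. That is, for every optimal mechanism $M$ there is a finitely supported probability distribution $\Delta$ over tuples of mappings $f^\delta=(f_1^\delta,\dots,f_n^\delta)$, where $f_i^\delta$ maps each type $t_i\in T_i$ to a bit $m_i^\delta(t_i)\in\{0,1\}$ and a virtual value $\phi_i^\delta(t_i)\in\mathbb{R}$, such that every mechanism of the following form is optimal and has the same interim form as $M$ (and mechanisms of this form exist): sample $f^\delta$ from $\Delta$; on profile $t$, award the item to some bidder $i^*\in\arg\max_i\phi_i^\delta(t_i)$, with ties broken arbitrarily, if $\phi_{i^*}^\delta(t_{i^*})\ge 0$, and to nobody if all virtual values are negative; charge the winner $i^*$ the amount $\min\{b_{i^*},v_{i^*}\}$ if $m_{i^*}^\delta(t_{i^*})=1$ and $0$ if $m_{i^*}^\delta(t_{i^*})=0$; charge all other bidders $0$. The same holds if incentive compatibility is required only against misreports $t_i'=(v'_i,b'_i)$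 with $b_i'\le b_i$, throughout the definitions of admissible and optimal (bidders who physically cannot pay more than their budget). -/

import Mathlib

open scoped NNReal

universe u

namespace BudgetAuction

/-- A type of a bidder: the pair `(v, b)` of her value for the item and her budget. -/
abbrev BidderType : Type := ℝ≥0 × ℝ≥0

/-- The value `v` of a type. -/
def value (t : BidderType) : ℝ := (t.1 : ℝ)

/-- The budget `b` of a type. -/
def budget (t : BidderType) : ℝ := (t.2 : ℝ)

/-- Profiles of types, where bidder `i` has the finite set `T i` of possible types. -/
abbrev Profile {n : ℕ} (T : Fin n → Finset BidderType) : Type := (i : Fin n) → T i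

/-- A randomized mechanism for one item. On a reported profile `t` and a random seed `ω`, the item
goes to `winner t ω` (to nobody if this is `none`) and bidder `i` pays `price t ω i`. -/
structure Mechanism {n : ℕ} (T : Fin n → Finset BidderType) where
  Seed : Type u
  [measurableSpaceSeed : MeasurableSpace Seed]
  seedLaw : MeasureTheory.Measure Seed
  [isProbabilityMeasure_seedLaw : MeasureTheory.IsProbabilityMeasure seedLaw]
  winner : Profile T → Seed → Option (Fin n)
  price : Profile T → Seed → Fin n → ℝ
  measurableSet_winner : ∀ t i, MeasurableSet {ω | winner t ω = some i}
  measurable_price : ∀ t i, Measurable (fun ω => price t ω i)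

attribute [instance] Mechanism.measurableSpaceSeed Mechanism.isProbabilityMeasure_seedLaw

/-- The two standard readings of a budget. `quasilinear`: the designer must respect budgets, and
the bidders are quasi-linear, so each type may misreport as every other. `hard`: a bidder cannot
pay more than her budget, and only misreports that do not overstate the budget are considered. -/
inductive BudgetModel : Type
  | quasilinear
  | hard

/-- The misreports against which a mechanism must be incentive compatible. -/
def BudgetModel.CanMisreport : BudgetModel → BidderType → BidderType → Prop
  | .quasilinear, _, _ => True
  | .hard, t, t' => budget t' ≤ budget t

section

variable {n : ℕ} {T : Fin n → Finset BidderType}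

namespace Mechanism

/-- `1` if bidder `i` receives the item and `0` otherwise. -/
noncomputable def alloc (M : Mechanism.{u} T) (t : Profile T) (ω : M.Seed) (i : Fin n) : ℝ :=
  if M.winner t ω = some i then 1 else 0

open Classical in
/-- The probability that bidder `i` receives the item when she reports `ti`, over the other
bidders' independent types and the seed. -/
noncomputable def interimAlloc (M : Mechanism.{u} T) (D : (i : Fin n) → PMF (T i))
    (i : Fin n) (ti : T i) : ℝ :=
  ∑ s : Profile T with s i = ti,
    (∏ j ∈ Finset.univ.erase i, (D j (s j)).toReal) * ∫ ω, M.alloc s ω i ∂M.seedLaw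

open Classical in
/-- The expected payment of bidder `i` when she reports `ti`, over the other bidders' independent
types and the seed. -/
noncomputable def interimPrice (M : Mechanism.{u} T) (D : (i : Fin n) → PMF (T i))
    (i : Fin n) (ti : T i) : ℝ :=
  ∑ s : Profile T with s i = ti,
    (∏ j ∈ Finset.univ.erase i, (D j (s j)).toReal) * ∫ ω, M.price s ω i ∂M.seedLaw

/-- Bayesian incentive compatibility, with respect to the misreports of the budget model. -/
def IsBIC (M : Mechanism.{u} T) (B : BudgetModel) (D : (i : Fin n) → PMF (T i)) : Prop :=
  ∀ (i : Fin n) (ti ti' : T i), B.CanMisreport ti ti' →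
    value ti * M.interimAlloc D i ti' - M.interimPrice D i ti' ≤
      value ti * M.interimAlloc D i ti - M.interimPrice D i ti

/-- Ex-post individual rationality. -/
def IsExPostIR (M : Mechanism.{u} T) : Prop :=
  ∀ (t : Profile T) (ω : M.Seed) (i : Fin n), M.price t ω i ≤ value (t i) * M.alloc t ω i

/-- Budgets are respected ex post. -/
def RespectsBudgets (M : Mechanism.{u} T) : Prop :=
  ∀ (t : Profile T) (ω : M.Seed) (i : Fin n), M.price t ω i ≤ budget (t i)

/-- No positive transfers. -/
def NoPositiveTransfers (M : Mechanism.{u} T) : Prop :=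
  ∀ (t : Profile T) (ω : M.Seed) (i : Fin n), 0 ≤ M.price t ω i

/-- The mechanisms over which the revenue is maximized. -/
def IsAdmissible (M : Mechanism.{u} T) (B : BudgetModel) (D : (i : Fin n) → PMF (T i)) : Prop :=
  M.IsBIC B D ∧ M.IsExPostIR ∧ M.RespectsBudgets ∧ M.NoPositiveTransfers

/-- The expected revenue when types are drawn independently from the `D i` and reported
truthfully. -/
noncomputable def revenue (M : Mechanism.{u} T) (D : (i : Fin n) → PMF (T i)) : ℝ :=
  ∑ t : Profile T, (∏ j, (D j (t j)).toReal) * ∑ i, ∫ ω, M.price t ω i ∂M.seedLaw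

/-- An optimal mechanism: admissible, and of maximal revenue among all admissible mechanisms. -/
def IsOptimal (M : Mechanism.{u} T) (B : BudgetModel) (D : (i : Fin n) → PMF (T i)) : Prop :=
  M.IsAdmissible B D ∧ ∀ M' : Mechanism.{u} T, M'.IsAdmissible B D → M'.revenue D ≤ M.revenue D

/-- Two mechanisms have the same interim form. -/
def SameInterimForm (M M' : Mechanism.{u} T) (D : (i : Fin n) → PMF (T i)) : Prop :=
  ∀ (i : Fin n) (ti : T i),
    M.interimAlloc D i ti = M'.interimAlloc D i ti ∧ M.interimPrice D i ti = M'.interimPrice D i ti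

end Mechanism

variable (T) in
/-- A tuple of mappings `(f₁, …, fₙ)`, where `fᵢ` takes each type of bidder `i` to an indicator bit
and a real virtual value. -/
abbrev VirtualMap : Type := (i : Fin n) → T i → Bool × ℝ

namespace VirtualMap

/-- The indicator bit of bidder `i` on the profile `t`. -/
def bit (f : VirtualMap T) (t : Profile T) (i : Fin n) : Bool := (f i (t i)).1

/-- The virtual value of bidder `i` on the profile `t`. -/
def virtualValue (f : VirtualMap T) (t : Profile T) (i : Fin n) : ℝ := (f i (t i)).2

/-- The item goes to some bidder of highest virtual value if that value is nonnegative, and to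
nobody otherwise. Ties may be broken in any way. -/
def IsMaximizer (f : VirtualMap T) (t : Profile T) : Option (Fin n) → Prop
  | some i => 0 ≤ f.virtualValue t i ∧ ∀ j, f.virtualValue t j ≤ f.virtualValue t i
  | none => ∀ j, f.virtualValue t j < 0

/-- The payments: the winner pays `min b v` if her bit is one; all other payments are zero. -/
noncomputable def charge (f : VirtualMap T) (t : Profile T) (w : Option (Fin n)) (i : Fin n) : ℝ :=
  if w = some i ∧ f.bit t i = true then min (budget (t i)) (value (t i)) else 0

end VirtualMap

/-- The mechanism `M` samples a tuple of mappings from `Δ`, independently of the reports, and on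
every profile chooses a maximizer of the virtual value and charges accordingly. Ties are broken
arbitrarily, possibly depending on the profile and on the rest of the seed. -/
def Mechanism.IsVirtualValueMaximizer (M : Mechanism.{u} T) (Δ : PMF (VirtualMap T)) : Prop :=
  ∃ δ : M.Seed → VirtualMap T, Measurable δ ∧ M.seedLaw.map δ = Δ.toMeasure ∧
    ∀ (t : Profile T) (ω : M.Seed), (δ ω).IsMaximizer t (M.winner t ω) ∧
      ∀ i, M.price t ω i = (δ ω).charge t (M.winner t ω) i

end

end BudgetAuction

/-! ### Interim expectations and the interim forms of deterministic outcomes. -/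

open MeasureTheory

namespace BudgetAuction

/-! Incentive compatibility and revenue depend on a mechanism only through its interim form, and the
ex-post constraints confine that form to a polytope: the convex hull of the finitely many
`outcomeForms`. It therefore suffices to implement every point of this polytope by virtual value
maximizers.

A linear functional of the interim form splits into a sum over profiles (`sum_mul_interim`). On each
profile it is maximized by charging a winner her cap exactly when the payment weight is positive,
and by awarding the item to a bidder with the largest weight per unit of type probability, provided
it is nonnegative. That ratio is the virtual value (`weightMap`, `weighted_sum_le`).

An extreme point is strictly separated from all other outcome forms, so it is the unique outcome
form maximizing some functional. Every tie-breaking rule for the associated virtual map then gives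
this same form (`exists_tieInvariant_of_mem_extremePoints`). A point of the polytope is a mixture of
extreme points, and the mixing weights give `Δ`. Existence of an optimum is compactness. -/

/-- Coordinates `(π, p)` of an interim form. -/
abbrev InterimForm {n : ℕ} (T : Fin n → Finset BidderType) : Type := (i : Fin n) → T i → ℝ × ℝ

variable {n : ℕ} {T : Fin n → Finset BidderType}

/-- The largest amount that a type may be charged when she receives the item. -/
noncomputable def cap (t : BidderType) : ℝ := min (budget t) (value t)

lemma cap_nonneg (t : BidderType) : 0 ≤ cap t :=
  le_min t.2.2 t.1.2

/-- The probability of the reports of all bidders but `i`. -/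
noncomputable def othersProb (D : (i : Fin n) → PMF (T i)) (s : Profile T) (i : Fin n) : ℝ :=
  ∏ j ∈ Finset.univ.erase i, (D j (s j)).toReal

lemma othersProb_nonneg (D : (i : Fin n) → PMF (T i)) (s : Profile T) (i : Fin n) :
    0 ≤ othersProb D s i :=
  Finset.prod_nonneg fun _ _ => ENNReal.toReal_nonneg

lemma mul_othersProb (D : (i : Fin n) → PMF (T i)) (s : Profile T) (i : Fin n) :
    (D i (s i)).toReal * othersProb D s i = ∏ j, (D j (s j)).toReal :=
  Finset.mul_prod_erase Finset.univ (fun j => (D j (s j)).toReal) (Finset.mem_univ i)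

open Classical in
/-- The conditional expectation of `y · i` given that bidder `i` reports `ti`. -/
noncomputable def interim (D : (i : Fin n) → PMF (T i)) (y : Profile T → Fin n → ℝ)
    (i : Fin n) (ti : T i) : ℝ :=
  ∑ s : Profile T with s i = ti, othersProb D s i * y s i

/-- Grouping the profiles by the report of bidder `i` turns a functional of the interim form into a
sum over profiles, which can be maximized one profile at a time. -/
lemma sum_mul_interim (D : (i : Fin n) → PMF (T i)) (α : (i : Fin n) → T i → ℝ)
    (y : Profile T → Fin n → ℝ) :
    ∑ i, ∑ ti, α i ti * interim D y i ti =
      ∑ s, ∑ i, othersProb D s i * (α i (s i) * y s i) := by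
  classical
  rw [Finset.sum_comm (s := (Finset.univ : Finset (Profile T)))]
  refine Finset.sum_congr rfl fun i _ => ?_
  rw [← Finset.sum_fiberwise Finset.univ (fun s : Profile T => s i)]
  refine Finset.sum_congr rfl fun ti _ => ?_
  rw [interim, Finset.mul_sum]
  refine Finset.sum_congr (by congr!) fun s hs => ?_
  rw [(Finset.mem_filter.1 hs).2]
  ring

lemma integral_interim (D : (i : Fin n) → PMF (T i)) {Ω : Type*} [MeasurableSpace Ω]
    (μ : Measure Ω) (y : Ω → Profile T → Fin n → ℝ)
    (hy : ∀ s i, Integrable (fun ω => y ω s i) μ) (i : Fin n) (ti : T i) :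
    interim D (fun s i => ∫ ω, y ω s i ∂μ) i ti = ∫ ω, interim D (y ω) i ti ∂μ := by
  simp only [interim]
  rw [integral_finsetSum _ fun s _ => (hy s i).const_mul _]
  simp only [integral_const_mul]

/-- The allocation that gives the item to the bidder `w`. -/
noncomputable def award (w : Option (Fin n)) (i : Fin n) : ℝ := if w = some i then 1 else 0

/-- The interim form of the deterministic outcome with winners `w` and the bits of `f`. -/
noncomputable def outcomeForm (D : (i : Fin n) → PMF (T i)) (f : VirtualMap T)
    (w : Profile T → Option (Fin n)) : InterimForm T := fun i ti =>
  (interim D (fun s => award (w s)) i ti, interim D (fun s => f.charge s (w s)) i ti)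

/-- The interim forms of deterministic outcomes. -/
def outcomeForms (D : (i : Fin n) → PMF (T i)) : Set (InterimForm T) :=
  Set.range fun p : ((i : Fin n) → T i → Bool) × (Profile T → Option (Fin n)) =>
    outcomeForm D (fun i ti => (p.1 i ti, 0)) p.2

lemma finite_outcomeForms (D : (i : Fin n) → PMF (T i)) : (outcomeForms D).Finite :=
  Set.finite_range _

/-- Once the winners are given, only the bits of `f` enter the charges, so its virtual values may be
replaced by `0`. -/
lemma outcomeForm_mem (D : (i : Fin n) → PMF (T i)) (f : VirtualMap T)
    (w : Profile T → Option (Fin n)) : outcomeForm D f w ∈ outcomeForms D :=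
  ⟨(fun i ti => (f i ti).1, w), rfl⟩

/-! ### Maximizers of a virtual map and their charges. -/

namespace VirtualMap

lemma exists_isMaximizer (f : VirtualMap T) (t : Profile T) : ∃ w, f.IsMaximizer t w := by
  by_cases h : ∃ i, 0 ≤ f.virtualValue t i
  · obtain ⟨i, hi⟩ := h
    have : Nonempty (Fin n) := ⟨i⟩
    obtain ⟨k, hk⟩ := Finite.exists_max (f.virtualValue t)
    exact ⟨some k, hi.trans (hk i), hk⟩
  · exact ⟨none, fun j => not_le.1 fun hj => h ⟨j, hj⟩⟩

/-- A choice of maximizers. -/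
noncomputable def selection (f : VirtualMap T) (t : Profile T) : Option (Fin n) :=
  (f.exists_isMaximizer t).choose

lemma isMaximizer_selection (f : VirtualMap T) (t : Profile T) :
    f.IsMaximizer t (f.selection t) :=
  (f.exists_isMaximizer t).choose_spec

lemma charge_nonneg (f : VirtualMap T) (t : Profile T) (w : Option (Fin n)) (i : Fin n) :
    0 ≤ f.charge t w i := by
  unfold charge
  split_ifs
  exacts [cap_nonneg _, le_rfl]

lemma charge_le (f : VirtualMap T) (t : Profile T) (w : Option (Fin n)) (i : Fin n) :
    f.charge t w i ≤ cap (t i) * award w i := by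
  unfold charge award
  by_cases h : w = some i
  · by_cases hb : f.bit t i = true
    · simp [h, hb, cap]
    · simpa [h, hb] using cap_nonneg (t i)
  · simp [h]

/-- All ways of breaking ties lead to the same interim form. -/
def TieInvariant (f : VirtualMap T) (D : (i : Fin n) → PMF (T i)) : Prop :=
  ∀ w : Profile T → Option (Fin n), (∀ t, f.IsMaximizer t (w t)) →
    outcomeForm D f w = outcomeForm D f f.selection

end VirtualMap

/-! ### The virtual values attached to a linear functional. -/

/-- The total weight of a type that receives the item, when an award has weight `α`, a payment has
weight `β`, and the payment is chosen optimally. -/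
noncomputable def awardWeight (α β : (i : Fin n) → T i → ℝ) (i : Fin n) (ti : T i) : ℝ :=
  α i ti + max (β i ti) 0 * cap ti

/-- A strict upper bound for the virtual values of types of positive probability. -/
noncomputable def virtualBound (D : (i : Fin n) → PMF (T i)) (α β : (i : Fin n) → T i → ℝ) : ℝ :=
  1 + ∑ i, ∑ ti, |awardWeight α β i ti / (D i ti).toReal|

open Classical in
/-- The virtual map whose maximizers maximize the linear functional with weights `α` and `β`. -/
noncomputable def weightMap (D : (i : Fin n) → PMF (T i)) (α β : (i : Fin n) → T i → ℝ) :
    VirtualMap T := fun i ti =>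
  (decide (0 < β i ti),
    -- On a profile where this is the only null type, the other bidders' awards carry no weight. So
    -- it has to beat all of them if its own weight is positive; otherwise it may safely lose.
    if (D i ti).toReal = 0 then if 0 < awardWeight α β i ti then virtualBound D α β else -1
    else awardWeight α β i ti / (D i ti).toReal)

lemma div_lt_virtualBound (D : (i : Fin n) → PMF (T i)) (α β : (i : Fin n) → T i → ℝ)
    (i : Fin n) (ti : T i) : awardWeight α β i ti / (D i ti).toReal < virtualBound D α β := by
  have h1 : |awardWeight α β i ti / (D i ti).toReal| ≤
      ∑ ti, |awardWeight α β i ti / (D i ti).toReal| :=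
    Finset.single_le_sum (f := fun ti => |awardWeight α β i ti / (D i ti).toReal|)
      (fun _ _ => abs_nonneg _) (Finset.mem_univ ti)
  have h2 : ∑ ti, |awardWeight α β i ti / (D i ti).toReal| ≤
      ∑ i, ∑ ti, |awardWeight α β i ti / (D i ti).toReal| :=
    Finset.single_le_sum (f := fun i => ∑ ti, |awardWeight α β i ti / (D i ti).toReal|)
      (fun _ _ => Finset.sum_nonneg fun _ _ => abs_nonneg _) (Finset.mem_univ i)
  have h3 := le_abs_self (awardWeight α β i ti / (D i ti).toReal)
  rw [virtualBound]
  linarith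

lemma virtualBound_pos (D : (i : Fin n) → PMF (T i)) (α β : (i : Fin n) → T i → ℝ) :
    0 < virtualBound D α β :=
  add_pos_of_pos_of_nonneg one_pos
    (Finset.sum_nonneg fun _ _ => Finset.sum_nonneg fun _ _ => abs_nonneg _)

lemma awardWeight_nonpos_of_neg {D : (i : Fin n) → PMF (T i)} {α β : (i : Fin n) → T i → ℝ}
    {i : Fin n} {ti : T i} (h : (weightMap D α β i ti).2 < 0) : awardWeight α β i ti ≤ 0 := by
  by_contra! hγ
  refine h.not_ge ?_
  simp only [weightMap, hγ, if_true]
  split_ifs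
  · exact (virtualBound_pos D α β).le
  · exact div_nonneg hγ.le ENNReal.toReal_nonneg

lemma awardWeight_nonneg_of_nonneg {D : (i : Fin n) → PMF (T i)} {α β : (i : Fin n) → T i → ℝ}
    {i : Fin n} {ti : T i} (h : 0 ≤ (weightMap D α β i ti).2) : 0 ≤ awardWeight α β i ti := by
  by_contra! hγ
  refine h.not_gt ?_
  simp only [weightMap, hγ.not_gt, if_false]
  split_ifs with h0
  · norm_num
  · exact div_neg_of_neg_of_pos hγ (lt_of_le_of_ne ENNReal.toReal_nonneg (Ne.symm h0))

/-- Multiplying virtual values by the probability of the profile turns the ratios back into weights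
times `othersProb`. Null types need separate treatment. -/
lemma othersProb_mul_awardWeight_le {D : (i : Fin n) → PMF (T i)} {α β : (i : Fin n) → T i → ℝ}
    {s : Profile T} {k : Fin n} (hk : (weightMap D α β).IsMaximizer s (some k)) (i : Fin n) :
    othersProb D s i * awardWeight α β i (s i) ≤
      othersProb D s k * awardWeight α β k (s k) := by
  have hk0 : 0 ≤ awardWeight α β k (s k) := awardWeight_nonneg_of_nonneg hk.1
  have hr := mul_nonneg (othersProb_nonneg D s k) hk0
  rcases (othersProb_nonneg D s i).eq_or_lt with hi | hi
  · simpa [← hi] using hr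
  rcases le_or_gt (awardWeight α β i (s i)) 0 with hγ | hγ
  · exact (mul_nonpos_of_nonneg_of_nonpos hi.le hγ).trans hr
  by_cases hik : i = k
  · rw [hik]
  -- Since `i ≠ k`, the factor of `k` occurs in the positive product `othersProb D s i`.
  have hDk : (D k (s k)).toReal ≠ 0 :=
    Finset.prod_ne_zero_iff.1 hi.ne' k (Finset.mem_erase.2 ⟨Ne.symm hik, Finset.mem_univ k⟩)
  have hle : (weightMap D α β i (s i)).2 ≤ (weightMap D α β k (s k)).2 := hk.2 i
  simp only [weightMap, hDk, if_false, hγ, if_true] at hle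
  split_ifs at hle with hDi
  -- A null type of positive weight has the virtual value `virtualBound`, which `k` cannot reach.
  · exact absurd hle (div_lt_virtualBound D α β k (s k)).not_ge
  · have hprod : 0 ≤ ∏ j, (D j (s j)).toReal :=
      Finset.prod_nonneg fun _ _ => ENNReal.toReal_nonneg
    have := mul_le_mul_of_nonneg_left hle hprod
    rw [← mul_othersProb D s i] at this
    nth_rewrite 2 [mul_othersProb D s i] at this
    rw [← mul_othersProb D s k] at this
    calc othersProb D s i * awardWeight α β i (s i)
        = (D i (s i)).toReal * othersProb D s i *
            (awardWeight α β i (s i) / (D i (s i)).toReal) := by field_simp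
      _ ≤ _ := this
      _ = othersProb D s k * awardWeight α β k (s k) := by field_simp

/-- The bit is one exactly when `β` is positive, so the charge attains the term `max β 0 * cap` of
`awardWeight`. -/
lemma weighted_charge (D : (i : Fin n) → PMF (T i)) (α β : (i : Fin n) → T i → ℝ)
    (s : Profile T) (w : Option (Fin n)) (i : Fin n) :
    α i (s i) * award w i + β i (s i) * (weightMap D α β).charge s w i =
      awardWeight α β i (s i) * award w i := by
  by_cases h : w = some i
  · rcases lt_or_ge 0 (β i (s i)) with hβ | hβ
    · simp [VirtualMap.charge, VirtualMap.bit, weightMap, award, awardWeight, h, hβ, hβ.le, cap]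
    · simp [VirtualMap.charge, VirtualMap.bit, weightMap, award, awardWeight, h, hβ, hβ.not_gt]
  · simp [VirtualMap.charge, award, h]

/-- On every profile, a maximizer for `weightMap D α β` maximizes the weighted sum among all random
outcomes that satisfy the ex-post constraints. -/
lemma weighted_sum_le (D : (i : Fin n) → PMF (T i)) (α β : (i : Fin n) → T i → ℝ)
    (s : Profile T) {x q : Fin n → ℝ} (hx : ∀ i, 0 ≤ x i) (hx1 : ∑ i, x i ≤ 1)
    (hq : ∀ i, 0 ≤ q i) (hqx : ∀ i, q i ≤ cap (s i) * x i) {w : Option (Fin n)}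
    (hw : (weightMap D α β).IsMaximizer s w) :
    ∑ i, othersProb D s i * (α i (s i) * x i + β i (s i) * q i) ≤
      ∑ i, othersProb D s i *
        (α i (s i) * award w i + β i (s i) * (weightMap D α β).charge s w i) := by
  simp only [weighted_charge]
  have h1 : ∀ i, othersProb D s i * (α i (s i) * x i + β i (s i) * q i) ≤
      othersProb D s i * awardWeight α β i (s i) * x i := fun i => by
    rw [mul_assoc]
    refine mul_le_mul_of_nonneg_left ?_ (othersProb_nonneg D s i)
    have h2 : β i (s i) * q i ≤ max (β i (s i)) 0 * (cap (s i) * x i) :=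
      (mul_le_mul_of_nonneg_right (le_max_left _ _) (hq i)).trans
        (mul_le_mul_of_nonneg_left (hqx i) (le_max_right _ _))
    rw [awardWeight]
    linarith
  refine (Finset.sum_le_sum fun i _ => h1 i).trans ?_
  cases w with
  | none =>
    simp only [award, reduceCtorEq, if_false, mul_zero, Finset.sum_const_zero]
    exact Finset.sum_nonpos fun i _ => mul_nonpos_of_nonpos_of_nonneg
      (mul_nonpos_of_nonneg_of_nonpos (othersProb_nonneg D s i)
        (awardWeight_nonpos_of_neg (hw i))) (hx i)
  | some k =>
    have hr : ∑ i, othersProb D s i * (awardWeight α β i (s i) * award (some k) i) =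
        othersProb D s k * awardWeight α β k (s k) := by
      simp [award]
    rw [hr]
    have hk0 := mul_nonneg (othersProb_nonneg D s k)
      (awardWeight_nonneg_of_nonneg (ti := s k) hw.1)
    calc ∑ i, othersProb D s i * awardWeight α β i (s i) * x i
        ≤ ∑ i, othersProb D s k * awardWeight α β k (s k) * x i :=
          Finset.sum_le_sum fun i _ =>
            mul_le_mul_of_nonneg_right (othersProb_mul_awardWeight_le hw i) (hx i)
      _ = othersProb D s k * awardWeight α β k (s k) * ∑ i, x i := (Finset.mul_sum ..).symm
      _ ≤ _ := mul_le_of_le_one_right hk0 hx1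

lemma award_nonneg (w : Option (Fin n)) (i : Fin n) : 0 ≤ award w i := by
  unfold award
  split_ifs <;> norm_num

lemma sum_award_le_one (w : Option (Fin n)) : ∑ i, award w i ≤ 1 := by
  cases w <;> simp [award]

/-! ### The polytope of interim forms and its extreme points. -/

/-- The interim form of a random outcome with award probabilities `x` and expected prices `q`. -/
noncomputable def randomForm (D : (i : Fin n) → PMF (T i)) (x q : Profile T → Fin n → ℝ) :
    InterimForm T := fun i ti => (interim D x i ti, interim D q i ti)

lemma exists_weights (f : InterimForm T →ₗ[ℝ] ℝ) : ∃ α β : (i : Fin n) → T i → ℝ,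
    ∀ z, f z = ∑ i, ∑ ti, (α i ti * (z i ti).1 + β i ti * (z i ti).2) := by
  classical
  let b (i : Fin n) (ti : T i) (c : ℝ × ℝ) : InterimForm T := Pi.single i (Pi.single ti c)
  refine ⟨fun i ti => f (b i ti (1, 0)), fun i ti => f (b i ti (0, 1)), fun z => ?_⟩
  have hz : z = ∑ i, ∑ ti, ((z i ti).1 • b i ti (1, 0) + (z i ti).2 • b i ti (0, 1)) := by
    have hb : ∀ i ti, (z i ti).1 • b i ti (1, 0) + (z i ti).2 • b i ti (0, 1) =
        b i ti (z i ti) := fun i ti => by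
      simp only [b, ← Pi.single_smul, ← Pi.single_add]
      simp
    simp only [hb, b]
    refine (Finset.univ_sum_single z).symm.trans (Finset.sum_congr rfl fun i _ => ?_)
    conv_lhs => rw [← Finset.univ_sum_single (z i)]
    exact map_sum (AddMonoidHom.single (fun i => T i → ℝ × ℝ) i) _ _
  conv_lhs => rw [hz]
  simp [map_sum, mul_comm]

lemma weights_randomForm (D : (i : Fin n) → PMF (T i)) (α β : (i : Fin n) → T i → ℝ)
    (x q : Profile T → Fin n → ℝ) :
    ∑ i, ∑ ti, (α i ti * (randomForm D x q i ti).1 + β i ti * (randomForm D x q i ti).2) =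
      ∑ s, ∑ i, othersProb D s i * (α i (s i) * x s i + β i (s i) * q s i) := by
  simp only [randomForm, Finset.sum_add_distrib, sum_mul_interim, mul_add]

/-- Every linear functional of the interim form is maximized by the maximizers of some virtual
map. -/
lemma exists_virtualMap_maximizing (D : (i : Fin n) → PMF (T i)) (f : InterimForm T →ₗ[ℝ] ℝ) :
    ∃ g : VirtualMap T, ∀ w : Profile T → Option (Fin n), (∀ t, g.IsMaximizer t (w t)) →
      ∀ x q : Profile T → Fin n → ℝ, (∀ s i, 0 ≤ x s i) → (∀ s, ∑ i, x s i ≤ 1) →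
        (∀ s i, 0 ≤ q s i) → (∀ s i, q s i ≤ cap (s i) * x s i) →
        f (randomForm D x q) ≤ f (outcomeForm D g w) := by
  obtain ⟨α, β, hf⟩ := exists_weights f
  refine ⟨weightMap D α β, fun w hw x q hx hx1 hq hqx => ?_⟩
  change _ ≤ f (randomForm D (fun s => award (w s)) fun s => (weightMap D α β).charge s (w s))
  rw [hf, hf, weights_randomForm, weights_randomForm]
  exact Finset.sum_le_sum fun s _ =>
    weighted_sum_le D α β s (hx s) (hx1 s) (hq s) (hqx s) (hw s)

/-- A point outside the hull would be strictly separated from it by some functional, but the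
maximizers of the corresponding virtual map do at least as well and lie in the hull. -/
lemma randomForm_mem_convexHull (D : (i : Fin n) → PMF (T i)) {x q : Profile T → Fin n → ℝ}
    (hx : ∀ s i, 0 ≤ x s i) (hx1 : ∀ s, ∑ i, x s i ≤ 1) (hq : ∀ s i, 0 ≤ q s i)
    (hqx : ∀ s i, q s i ≤ cap (s i) * x s i) :
    randomForm D x q ∈ convexHull ℝ (outcomeForms D) := by
  by_contra h
  obtain ⟨f, u, hfu, hu⟩ := geometric_hahn_banach_closed_point (convex_convexHull ℝ _)
    ((finite_outcomeForms D).isClosed_convexHull ℝ) h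
  obtain ⟨g, hg⟩ := exists_virtualMap_maximizing D f.toLinearMap
  have h1 : f (randomForm D x q) ≤ f (outcomeForm D g g.selection) :=
    hg _ g.isMaximizer_selection x q hx hx1 hq hqx
  have h2 := hfu _ (subset_convexHull ℝ _ (outcomeForm_mem D g g.selection))
  linarith

/-- Separating `e` from the hull of the other outcome forms makes it the unique maximizer of a
functional, so every tie-breaking of the corresponding virtual map must yield `e`. -/
lemma exists_tieInvariant_of_mem_extremePoints {D : (i : Fin n) → PMF (T i)} {e : InterimForm T}
    (he : e ∈ (convexHull ℝ (outcomeForms D)).extremePoints ℝ) :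
    ∃ g : VirtualMap T, g.TieInvariant D ∧ outcomeForm D g g.selection = e := by
  have heS : e ∈ outcomeForms D := extremePoints_convexHull_subset he
  have hsub : outcomeForms D \ {e} ⊆ outcomeForms D := Set.sdiff_subset
  -- If `e` lay in the hull of the other points it would be extreme there too, hence be one of those
  -- points.
  have hne : e ∉ convexHull ℝ (outcomeForms D \ {e}) := fun h =>
    (extremePoints_convexHull_subset (inter_extremePoints_subset_extremePoints_of_subset
      (convexHull_mono hsub) ⟨h, he⟩)).2 rfl
  obtain ⟨f, u, hfu, hu⟩ := geometric_hahn_banach_closed_point (convex_convexHull ℝ _)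
    (((finite_outcomeForms D).subset hsub).isClosed_convexHull ℝ) hne
  obtain ⟨g, hg⟩ := exists_virtualMap_maximizing D f.toLinearMap
  have key : ∀ w : Profile T → Option (Fin n), (∀ t, g.IsMaximizer t (w t)) →
      outcomeForm D g w = e := fun w hw => by
    by_contra hwe
    have h1 := hfu _ (subset_convexHull ℝ _ ⟨outcomeForm_mem D g w, hwe⟩)
    obtain ⟨⟨m, w'⟩, rfl⟩ := heS
    have h2 : f (outcomeForm D (fun i ti => (m i ti, 0)) w') ≤ f (outcomeForm D g w) :=
      hg w hw _ _ (fun s => award_nonneg (w' s)) (fun s => sum_award_le_one (w' s))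
        (fun s => VirtualMap.charge_nonneg _ s (w' s)) (fun s => VirtualMap.charge_le _ s (w' s))
    exact lt_asymm h1 (hu.trans_le h2)
  have hsel := key _ g.isMaximizer_selection
  exact ⟨g, fun w hw => (key w hw).trans hsel.symm, hsel⟩

/-- Krein–Milman; the closure is superfluous because there are finitely many extreme points. -/
lemma mem_convexHull_tieInvariant {D : (i : Fin n) → PMF (T i)} {z : InterimForm T}
    (hz : z ∈ convexHull ℝ (outcomeForms D)) :
    z ∈ convexHull ℝ {e | ∃ g : VirtualMap T,
      g.TieInvariant D ∧ outcomeForm D g g.selection = e} := by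
  have hfin := finite_outcomeForms D
  rw [← closure_convexHull_extremePoints (hfin.isCompact_convexHull ℝ) (convex_convexHull ℝ _),
    ((hfin.subset extremePoints_convexHull_subset).isClosed_convexHull ℝ).closure_eq] at hz
  exact convexHull_mono (fun e he => exists_tieInvariant_of_mem_extremePoints he) hz

/-! ### Mechanisms and their interim forms. -/

namespace Mechanism

/-- The interim form of a mechanism. -/
noncomputable def form (M : Mechanism.{u} T) (D : (i : Fin n) → PMF (T i)) : InterimForm T :=
  fun i ti => (M.interimAlloc D i ti, M.interimPrice D i ti)

lemma form_eq_randomForm (M : Mechanism.{u} T) (D : (i : Fin n) → PMF (T i)) :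
    M.form D = randomForm D (fun s i => ∫ ω, M.alloc s ω i ∂M.seedLaw)
      fun s i => ∫ ω, M.price s ω i ∂M.seedLaw :=
  rfl

lemma sameInterimForm_of_form_eq {M M' : Mechanism.{u} T} {D : (i : Fin n) → PMF (T i)}
    (h : M.form D = M'.form D) : M.SameInterimForm M' D := fun i ti =>
  Prod.ext_iff.1 (congrFun (congrFun h i) ti)

/-- The expected revenue as a function of the interim form. -/
noncomputable def formRevenue (D : (i : Fin n) → PMF (T i)) (z : InterimForm T) : ℝ :=
  ∑ i, ∑ ti, (D i ti).toReal * (z i ti).2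

lemma revenue_eq (M : Mechanism.{u} T) (D : (i : Fin n) → PMF (T i)) :
    M.revenue D = formRevenue D (M.form D) := by
  refine Eq.trans ?_ (sum_mul_interim D (fun i ti => (D i ti).toReal)
    fun s i => ∫ ω, M.price s ω i ∂M.seedLaw).symm
  refine Finset.sum_congr rfl fun s _ => ?_
  rw [Finset.mul_sum]
  refine Finset.sum_congr rfl fun i _ => ?_
  rw [← mul_othersProb D s i]
  ring

/-- Bayesian incentive compatibility as a property of the interim form. -/
def FormBIC (B : BudgetModel) (z : InterimForm T) : Prop :=
  ∀ (i : Fin n) (ti ti' : T i), B.CanMisreport ti ti' →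
    value ti * (z i ti').1 - (z i ti').2 ≤ value ti * (z i ti).1 - (z i ti).2

/-- The ex-post constraints. -/
def IsExPostFeasible (M : Mechanism.{u} T) : Prop :=
  M.IsExPostIR ∧ M.RespectsBudgets ∧ M.NoPositiveTransfers

lemma isAdmissible_iff {M : Mechanism.{u} T} {B : BudgetModel} {D : (i : Fin n) → PMF (T i)} :
    M.IsAdmissible B D ↔ FormBIC B (M.form D) ∧ M.IsExPostFeasible :=
  Iff.rfl

lemma measurable_alloc (M : Mechanism.{u} T) (t : Profile T) (i : Fin n) :
    Measurable fun ω => M.alloc t ω i :=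
  Measurable.ite (M.measurableSet_winner t i) measurable_const measurable_const

lemma integrable_alloc (M : Mechanism.{u} T) (t : Profile T) (i : Fin n) :
    Integrable (fun ω => M.alloc t ω i) M.seedLaw := by
  refine Integrable.of_bound (M.measurable_alloc t i).aestronglyMeasurable 1
    (Filter.Eventually.of_forall fun ω => ?_)
  unfold alloc
  split_ifs <;> simp

lemma price_le_cap_mul {M : Mechanism.{u} T} (hM : M.IsExPostFeasible) (t : Profile T)
    (ω : M.Seed) (i : Fin n) : M.price t ω i ≤ cap (t i) * M.alloc t ω i := by
  have h1 := hM.1 t ω i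
  have h2 := hM.2.1 t ω i
  unfold alloc at h1 ⊢
  split_ifs at h1 ⊢
  · rw [mul_one] at h1 ⊢
    exact le_min h2 h1
  · simpa using h1

lemma integrable_price {M : Mechanism.{u} T} (hM : M.IsExPostFeasible) (t : Profile T)
    (i : Fin n) : Integrable (fun ω => M.price t ω i) M.seedLaw := by
  refine Integrable.of_bound (M.measurable_price t i).aestronglyMeasurable (budget (t i))
    (Filter.Eventually.of_forall fun ω => ?_)
  rw [Real.norm_of_nonneg (hM.2.2 t ω i)]
  exact hM.2.1 t ω i

/-- The ex-post constraints are linear in award and price, so they survive averaging over the seed.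
-/
lemma form_mem_convexHull {M : Mechanism.{u} T} (hM : M.IsExPostFeasible)
    (D : (i : Fin n) → PMF (T i)) : M.form D ∈ convexHull ℝ (outcomeForms D) := by
  rw [form_eq_randomForm]
  refine randomForm_mem_convexHull D
    (fun s i => integral_nonneg fun ω => award_nonneg (M.winner s ω) i) (fun s => ?_)
    (fun s i => integral_nonneg fun ω => hM.2.2 s ω i) (fun s i => ?_)
  · rw [← integral_finsetSum _ fun i _ => M.integrable_alloc s i]
    refine (integral_mono (integrable_finsetSum _ fun i _ => M.integrable_alloc s i)
      (integrable_const 1) fun ω => sum_award_le_one (M.winner s ω)).trans ?_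
    simp
  · rw [← integral_const_mul]
    exact integral_mono (integrable_price hM s i) ((M.integrable_alloc s i).const_mul _)
      fun ω => price_le_cap_mul hM s ω i

lemma IsVirtualValueMaximizer.isExPostFeasible {M : Mechanism.{u} T} {Δ : PMF (VirtualMap T)}
    (hM : M.IsVirtualValueMaximizer Δ) : M.IsExPostFeasible := by
  obtain ⟨δ, -, -, h⟩ := hM
  have hle : ∀ t ω i, M.price t ω i ≤ cap (t i) * M.alloc t ω i := fun t ω i => by
    rw [(h t ω).2 i]
    exact (δ ω).charge_le t _ i
  have h0 : ∀ t ω i, 0 ≤ M.alloc t ω i := fun t ω i => award_nonneg (M.winner t ω) i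
  have h1 : ∀ t ω i, M.alloc t ω i ≤ 1 := fun t ω i => by
    unfold alloc
    split_ifs <;> norm_num
  refine ⟨fun t ω i => (hle t ω i).trans
      (mul_le_mul_of_nonneg_right (min_le_right _ _) (h0 t ω i)),
    fun t ω i => (hle t ω i).trans
      ((mul_le_of_le_one_right (cap_nonneg _) (h1 t ω i)).trans (min_le_left _ _)),
    fun t ω i => ?_⟩
  rw [(h t ω).2 i]
  exact (δ ω).charge_nonneg t _ i

end Mechanism

/-! ### Sampling a virtual map from a finitely supported law. -/

/-- The seed may contain more randomness than `δ`, but almost surely `G` is determined by the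
sampled value. -/
lemma integral_eq_sum_of_map_eq {Ω α : Type*} [MeasurableSpace Ω] [MeasurableSpace α]
    [MeasurableSingletonClass α] {μ : Measure Ω} {p : PMF α} {δ : Ω → α} (hδ : Measurable δ)
    (hp : μ.map δ = p.toMeasure) {A : Finset α} (hA : p.support ⊆ A) {G : Ω → ℝ} {c : α → ℝ}
    (hG : ∀ ω, δ ω ∈ p.support → G ω = c (δ ω)) :
    ∫ ω, G ω ∂μ = ∑ a ∈ A, (p a).toReal * c a := by
  classical
  have hfin : p.support.Finite := A.finite_toSet.subset hA
  have hae : ∀ᵐ ω ∂μ, δ ω ∈ p.support := by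
    refine ae_of_ae_map hδ.aemeasurable ?_
    rw [hp, ae_iff]
    refine (p.toMeasure_apply_eq_zero_iff hfin.measurableSet.compl).2 ?_
    exact disjoint_compl_right
  have hmeas : ∀ a, MeasurableSet (δ ⁻¹' {a}) := fun a => hδ (measurableSet_singleton a)
  have hμ : ∀ a, μ (δ ⁻¹' {a}) = p a := fun a => by
    rw [← Measure.map_apply hδ (measurableSet_singleton a), hp,
      p.toMeasure_apply_singleton a (measurableSet_singleton a)]
  calc ∫ ω, G ω ∂μ = ∫ ω, ∑ a ∈ A, (δ ⁻¹' {a}).indicator (fun _ => c a) ω ∂μ := by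
        refine integral_congr_ae (hae.mono fun ω hω => ?_)
        simp only [Set.indicator_apply, Set.mem_preimage, Set.mem_singleton_iff]
        rw [Finset.sum_ite_eq, if_pos (Finset.mem_coe.1 (hA hω)), hG ω hω]
    _ = ∑ a ∈ A, (p a).toReal * c a := by
        rw [integral_finsetSum]
        · refine Finset.sum_congr rfl fun a _ => ?_
          rw [integral_indicator_const _ (hmeas a), Measure.real, hμ, smul_eq_mul]
        · intro a _
          refine (integrable_indicator_iff (hmeas a)).2 (integrableOn_const ?_)
          rw [hμ]
          exact p.apply_ne_top a

namespace Mechanism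

/-- If all maps in the support of `Δ` are tie invariant, then the interim form of a virtual value
maximizer is the average over `Δ`. -/
lemma IsVirtualValueMaximizer.form_eq {M : Mechanism.{u} T} {Δ : PMF (VirtualMap T)}
    (hM : M.IsVirtualValueMaximizer Δ) {D : (i : Fin n) → PMF (T i)}
    {A : Finset (VirtualMap T)} (hA : Δ.support ⊆ A) (hΔ : ∀ g ∈ Δ.support, g.TieInvariant D) :
    M.form D = fun i ti =>
      (∑ g ∈ A, (Δ g).toReal * (outcomeForm D g g.selection i ti).1,
        ∑ g ∈ A, (Δ g).toReal * (outcomeForm D g g.selection i ti).2) := by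
  have hfeas := hM.isExPostFeasible
  obtain ⟨δ, hδ, hmap, h⟩ := hM
  -- For a fixed seed the outcome is deterministic, and tie invariance removes the dependence on how
  -- that seed breaks ties.
  have hform : ∀ ω, δ ω ∈ Δ.support →
      randomForm D (fun s => M.alloc s ω) (fun s => M.price s ω) =
        outcomeForm D (δ ω) (δ ω).selection := fun ω hω => by
    rw [← hΔ _ hω (fun s => M.winner s ω) fun s => (h s ω).1]
    have hprice : (fun s => M.price s ω) = fun s => (δ ω).charge s (M.winner s ω) :=
      funext fun s => funext fun i => (h s ω).2 i
    rw [hprice]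
    rfl
  rw [form_eq_randomForm]
  funext i ti
  refine Prod.ext ?_ ?_
  · exact (integral_interim D M.seedLaw (fun ω s i => M.alloc s ω i)
      (fun s i => M.integrable_alloc s i) i ti).trans
      (integral_eq_sum_of_map_eq hδ hmap hA
        (c := fun g => (outcomeForm D g g.selection i ti).1) fun ω hω => by
          rw [← hform ω hω]; rfl)
  · exact (integral_interim D M.seedLaw (fun ω s i => M.price s ω i)
      (fun s i => integrable_price hfeas s i) i ti).trans
      (integral_eq_sum_of_map_eq hδ hmap hA
        (c := fun g => (outcomeForm D g g.selection i ti).2) fun ω hω => by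
          rw [← hform ω hω]; rfl)

/-- The mechanism that samples a virtual map from the family `g` with law `p` and allocates by
`VirtualMap.selection`. -/
noncomputable def ofFamily {ι : Type} (p : PMF ι) (g : ι → VirtualMap T) : Mechanism.{u} T :=
  letI : MeasurableSpace (ULift.{u} ι) := ⊤
  { Seed := ULift.{u} ι
    seedLaw := (p.map ULift.up).toMeasure
    winner := fun t k => (g k.down).selection t
    price := fun t k i => (g k.down).charge t ((g k.down).selection t) i
    measurableSet_winner := fun _ _ => trivial
    measurable_price := fun _ _ => measurable_from_top }

lemma ofFamily_isVirtualValueMaximizer {ι : Type} (p : PMF ι) (g : ι → VirtualMap T) :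
    (ofFamily.{u} p g).IsVirtualValueMaximizer (p.map g) := by
  let _ : MeasurableSpace (ULift.{u} ι) := ⊤
  refine ⟨fun k => g k.down, measurable_from_top, ?_,
    fun t k => ⟨(g k.down).isMaximizer_selection t, fun i => rfl⟩⟩
  refine (PMF.toMeasure_map (fun k : ULift.{u} ι => g k.down) (p.map ULift.up)
    measurable_from_top).trans ?_
  rw [PMF.map_comp]
  rfl

lemma ofFamily_form {ι : Type} [Fintype ι] (p : PMF ι) (g : ι → VirtualMap T)
    (D : (i : Fin n) → PMF (T i)) :
    (ofFamily.{u} p g).form D =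
      ∑ k, (p k).toReal • outcomeForm D (g k) (g k).selection := by
  let _ : MeasurableSpace (ULift.{u} ι) := ⊤
  have hint : ∀ c : ULift.{u} ι → ℝ, ∫ k, c k ∂(p.map ULift.up).toMeasure =
      ∑ k, (p k).toReal * c (ULift.up k) := fun c => by
    let _ : MeasurableSpace ι := ⊤
    rw [← PMF.toMeasure_map ULift.up p measurable_from_top,
      integral_map measurable_from_top.aemeasurable measurable_from_top.aestronglyMeasurable,
      PMF.integral_eq_sum]
    rfl
  have hfeas := (ofFamily_isVirtualValueMaximizer.{u} p g).isExPostFeasible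
  rw [form_eq_randomForm]
  funext i ti
  simp only [Finset.sum_apply, Pi.smul_apply]
  refine Prod.ext ?_ ?_
  · rw [Prod.fst_sum]
    exact (integral_interim D _ (fun ω s i => (ofFamily.{u} p g).alloc s ω i)
      (fun s i => integrable_alloc _ s i) i ti).trans (hint _)
  · rw [Prod.snd_sum]
    exact (integral_interim D _ (fun ω s i => (ofFamily.{u} p g).price s ω i)
      (fun s i => integrable_price hfeas s i) i ti).trans (hint _)

end Mechanism

/-- Every convex combination of forms of deterministic outcomes is implemented by a distribution
over virtual value maximizers. -/
theorem exists_virtualValueMaximizer_form_eq {D : (i : Fin n) → PMF (T i)} {z : InterimForm T}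
    (hz : z ∈ convexHull ℝ (outcomeForms D)) :
    ∃ Δ : PMF (VirtualMap T), Δ.support.Finite ∧
      (∃ M : Mechanism.{u} T, M.IsVirtualValueMaximizer Δ) ∧
      ∀ M : Mechanism.{u} T, M.IsVirtualValueMaximizer Δ → M.form D = z := by
  obtain ⟨ι, _, w, e, hw0, hw1, he, rfl⟩ :=
    mem_convexHull_iff_exists_fintype.1 (mem_convexHull_tieInvariant hz)
  choose g hg hge using he
  let p : PMF ι := PMF.ofFintype (fun k => ENNReal.ofReal (w k)) (by
    rw [← ENNReal.ofReal_sum_of_nonneg fun k _ => hw0 k, hw1, ENNReal.ofReal_one])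
  have hp : ∀ k, (p k).toReal = w k := fun k => ENNReal.toReal_ofReal (hw0 k)
  have hsupp : (p.map g).support ⊆ Set.range g := by
    rw [PMF.support_map]
    exact Set.image_subset_range _ _
  have hfin : (p.map g).support.Finite := (Set.finite_range g).subset hsupp
  have htie : ∀ f ∈ (p.map g).support, f.TieInvariant D := fun f hf => by
    obtain ⟨k, rfl⟩ := hsupp hf
    exact hg k
  have hA : (p.map g).support ⊆ (hfin.toFinset : Set (VirtualMap T)) := hfin.coe_toFinset.ge
  have hcan := Mechanism.ofFamily_isVirtualValueMaximizer.{u} p g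
  refine ⟨p.map g, hfin, ⟨_, hcan⟩, fun M hM => ?_⟩
  -- The family `g` need not be injective. Comparison with the canonical mechanism avoids
  -- regrouping: both forms are the same average over `Δ`, and the canonical one is also a sum over
  -- the index set.
  rw [hM.form_eq hA htie, ← hcan.form_eq hA htie, Mechanism.ofFamily_form]
  simp only [hp, hge]

/-! ### Existence of an optimal mechanism. -/

/-- The mechanism that never sells. -/
noncomputable def Mechanism.noSale : Mechanism.{u} T where
  Seed := PUnit
  seedLaw := Measure.dirac PUnit.unit
  winner _ _ := none
  price _ _ _ := 0
  measurableSet_winner _ _ := trivial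
  measurable_price _ _ := measurable_const

lemma Mechanism.noSale_isAdmissible (B : BudgetModel) (D : (i : Fin n) → PMF (T i)) :
    (noSale.{u} : Mechanism T).IsAdmissible B D := by
  refine ⟨fun i ti ti' _ => ?_, fun t ω i => ?_, fun t ω i => (t i).1.2.2, fun t ω i => le_rfl⟩
  · have ha : ∀ ti, (noSale.{u} : Mechanism T).interimAlloc D i ti = 0 := fun ti =>
      Finset.sum_eq_zero fun s _ => mul_eq_zero_of_right _ (integral_eq_zero_of_ae
        (Filter.Eventually.of_forall fun ω => by simp [alloc, noSale]))
    have hp : ∀ ti, (noSale.{u} : Mechanism T).interimPrice D i ti = 0 := fun ti =>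
      Finset.sum_eq_zero fun s _ => mul_eq_zero_of_right _ (integral_eq_zero_of_ae
        (Filter.Eventually.of_forall fun ω => rfl))
    simp only [ha, hp, le_refl]
  · simp [alloc, noSale]

lemma isClosed_setOf_formBIC (B : BudgetModel) :
    IsClosed {z : InterimForm T | Mechanism.FormBIC B z} := by
  simp only [Mechanism.FormBIC, Set.ofPred_forall]
  refine isClosed_iInter fun i => isClosed_iInter fun ti => isClosed_iInter fun ti' =>
    isClosed_iInter fun _ => isClosed_le ?_ ?_ <;> fun_prop

/-- Revenue is continuous on the compact set of incentive compatible points of the polytope, which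
is nonempty by `noSale`; a maximizing point is then the form of an actual mechanism. -/
theorem exists_isOptimal (B : BudgetModel) (D : (i : Fin n) → PMF (T i)) :
    ∃ M : Mechanism.{u} T, M.IsOptimal B D := by
  have hcompact : IsCompact (convexHull ℝ (outcomeForms D) ∩
      {z : InterimForm T | Mechanism.FormBIC B z}) :=
    ((finite_outcomeForms D).isCompact_convexHull ℝ).inter_right (isClosed_setOf_formBIC B)
  have hmem : ∀ M : Mechanism.{u} T, M.IsAdmissible B D →
      M.form D ∈ convexHull ℝ (outcomeForms D) ∩
        {z : InterimForm T | Mechanism.FormBIC B z} := fun M hM =>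
    ⟨Mechanism.form_mem_convexHull hM.2 D, hM.1⟩
  have hcont : Continuous (Mechanism.formRevenue (T := T) D) := by
    unfold Mechanism.formRevenue
    fun_prop
  obtain ⟨z, ⟨hz, hzB⟩, hmax⟩ := hcompact.exists_isMaxOn
    ⟨_, hmem _ (Mechanism.noSale_isAdmissible B D)⟩ hcont.continuousOn
  obtain ⟨Δ, -, ⟨M, hM⟩, hform⟩ := exists_virtualValueMaximizer_form_eq.{u} hz
  have hMz := hform M hM
  refine ⟨M, Mechanism.isAdmissible_iff.2 ⟨hMz ▸ hzB, hM.isExPostFeasible⟩, fun M' hM' => ?_⟩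
  rw [Mechanism.revenue_eq, Mechanism.revenue_eq, hMz]
  exact hmax (hmem M' hM')

end BudgetAuction

open BudgetAuction in
theorem mainTheorem5 {n : ℕ} (T : Fin n → Finset BidderType) (D : (i : Fin n) → PMF (T i))
    (B : BudgetModel) :
    (∃ M : Mechanism.{u} T, M.IsOptimal B D) ∧
    ∀ M : Mechanism.{u} T, M.IsOptimal B D →
      ∃ Δ : PMF (VirtualMap T), Δ.support.Finite ∧
        (∃ M' : Mechanism.{u} T, M'.IsVirtualValueMaximizer Δ) ∧
        ∀ M' : Mechanism.{u} T, M'.IsVirtualValueMaximizer Δ →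
          M'.IsOptimal B D ∧ M'.SameInterimForm M D := by
  refine ⟨exists_isOptimal B D, fun M hM => ?_⟩
  obtain ⟨Δ, hfin, hex, hform⟩ := exists_virtualValueMaximizer_form_eq.{u}
    (Mechanism.form_mem_convexHull hM.1.2 D)
  refine ⟨Δ, hfin, hex, fun M' hM' => ?_⟩
  have heq := hform M' hM'
  refine ⟨⟨Mechanism.isAdmissible_iff.2 ⟨heq ▸ hM.1.1, hM'.isExPostFeasible⟩, fun N hN => ?_⟩,
    Mechanism.sameInterimForm_of_form_eq heq⟩
  rw [M'.revenue_eq, heq, ← M.revenue_eq]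
  exact hM.2 N hN
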